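/- Let $H$ be a finite-dimensional Hopf $*$-algebra over $\mathbb{C}$: a finite-dimensional complex Hopf algebra with an antilinear involutive anti-algebra map $*$ such that $\Delta(h^*)=(\Delta h)^{*\otimes *}$, $\epsilon(h^*)=\overline{\epsilon(h)}$ and $(S\circ *)^2=\mathrm{id}$. For $h,g\in H$ and $\phi\in H^*$ let $h\triangleright g=hg$ and $\phi\triangleright g=\sum g_{(1)}\,\phi(g_{(2)})$, and let $\phi^*\in H^*$ be given by $\phi^*(h)=\overline{\phi((Sh)^*)}$. Every operator in $\mathrm{Lin}(H)$ is a sum of operators $(h\triangleright)\circ(\phi\triangleright)$, and the antilinear map $*$ on $\mathrm{Lin}(H)$ with $\big((h\triangleright)\circ(\phi\triangleright)\big)^*=(\phi^*\triangleright)\circ(h^*\triangleright)$ is well defined. (1) This map makes $\mathrm{Lin}(H)$ a $*$-algebra: it is involutive and reverses products. Moreover $(h\triangleright)^*=h^*\triangleright$ and $(\phi\triangleright)^*=\phi^*\triangleright$. (2) The fundamental operator $W$ on $H\otimes H$, $W(g\otimes h)=\sum g_{(1)}\otimes g_{(2)}h$, is invertible with inverse $W^{-1}(g\otimes h)=\sum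 g_{(1)}\otimes (Sg_{(2)})h$, and it is unitary: $$W^{*\otimes *}=W^{-1},$$ where $*\otimes *$ acts on $\mathrm{Lin}(H\otimes H)=\mathrm{Lin}(H)\otimes\mathrm{Lin}(H)$. (3) Call a linear functional $\int:H\to\mathbb{C}$ a right-invariant integral if $(\int\otimes\mathrm{id})\Delta h=(\int h)\,1$ for all $h\in H$. There is a nonzero right-invariant integral. It is unique up to a complex scalar multiple, and it can be scaled so that the sesquilinear form $(g,h)=\int g^*h$ is hermitian, $(g,h)=\overline{(h,g)}$ for all $g,h\in H$. (4) For every right-invariant integral $\int$, and all $g,g',h\in H$ and $\phi\in H^*$, $$\int (h\triangleright g)^*g'=\int g^*(h^*\triangleright g'),\qquad \int(\phi\triangleright g)^*g'=\int g^*(\phi^*\triangleright g').$$ -/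

import Mathlib

open scoped TensorProduct ComplexConjugate

noncomputable section

/-- A Hopf `*`-algebra: a Hopf algebra over `ℂ` which is a `*`-algebra (the antilinear involutive
anti-algebra map is given by `StarRing` and `StarModule`), such that `Δ(h*) = (Δh)^{*⊗*}`,
`ε(h*)` is the conjugate of `ε(h)`, and `(S ∘ *)² = id`. -/
class HopfStarAlgebra (H : Type*) [Ring H] [StarRing H] [HopfAlgebra ℂ H] [StarModule ℂ H] :
    Prop where
  comul_star : ∀ h : H, Coalgebra.comul (R := ℂ) (star h) = star (Coalgebra.comul (R := ℂ) h)
  counit_star : ∀ h : H, Coalgebra.counit (R := ℂ) (star h) = conj (Coalgebra.counit (R := ℂ) h)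
  antipode_star : ∀ h : H,
    HopfAlgebra.antipode ℂ (star (HopfAlgebra.antipode ℂ (star h))) = h

namespace HopfStarAlgebra

section Operators

variable {H : Type*} [Ring H] [HopfAlgebra ℂ H]

/-- The left regular representation `h ▷ g = h g`. -/
def leftReg : H →ₗ[ℂ] Module.End ℂ H := LinearMap.mul ℂ H

/-- The left coregular representation `φ ▷ g = g₍₁₎ φ(g₍₂₎)`. -/
def coreg : Module.Dual ℂ H →ₗ[ℂ] Module.End ℂ H where
  toFun φ := (TensorProduct.rid ℂ H).toLinearMap ∘ₗ φ.lTensor H ∘ₗ Coalgebra.comul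
  map_add' φ ψ := by rw [LinearMap.lTensor_add, LinearMap.add_comp, LinearMap.comp_add]
  map_smul' c φ := by
    rw [LinearMap.lTensor_smul, LinearMap.smul_comp, LinearMap.comp_smul, RingHom.id_apply]

/-- The linear map underlying the representation of the Weyl algebra `H ⊗ H*` on `H`,
`h ⊗ φ ↦ (h ▷) ∘ (φ ▷)`. -/
def weylRep : H ⊗[ℂ] Module.Dual ℂ H →ₗ[ℂ] Module.End ℂ H :=
  TensorProduct.lift ((LinearMap.mul ℂ (Module.End ℂ H)).compl₁₂ leftReg coreg)

/-- The fundamental operator `W(g ⊗ h) = g₍₁₎ ⊗ g₍₂₎ h`. -/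
def fundOp (H : Type*) [Ring H] [HopfAlgebra ℂ H] : Module.End ℂ (H ⊗[ℂ] H) :=
  (LinearMap.mul' ℂ H).lTensor H ∘ₗ (TensorProduct.assoc ℂ H H H).toLinearMap ∘ₗ
    (Coalgebra.comul (R := ℂ) (A := H)).rTensor H

/-- The operator `g ⊗ h ↦ g₍₁₎ ⊗ S(g₍₂₎) h`. -/
def fundOpInv (H : Type*) [Ring H] [HopfAlgebra ℂ H] : Module.End ℂ (H ⊗[ℂ] H) :=
  (LinearMap.mul' ℂ H ∘ₗ (HopfAlgebra.antipode ℂ).rTensor H).lTensor H ∘ₗ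
    (TensorProduct.assoc ℂ H H H).toLinearMap ∘ₗ
    (Coalgebra.comul (R := ℂ) (A := H)).rTensor H

/-- Right-invariant integrals on `H`: functionals with `(∫ ⊗ id) Δ h = (∫ h) 1`, that is
`(∫ h₍₁₎) h₍₂₎ = (∫ h) 1`, for all `h`. For functions on a group this says that
`∫ f(x y) dx = ∫ f(x) dx`. -/
def IsRightIntegral (I : Module.Dual ℂ H) : Prop :=
  ∀ h : H, TensorProduct.lid ℂ H (I.rTensor H (Coalgebra.comul h)) = I h • (1 : H)

end Operators

section Star

variable {H : Type*} [Ring H] [StarRing H] [HopfAlgebra ℂ H] [StarModule ℂ H]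

/-- The `*`-structure of `H*`: `φ*(h)` is the conjugate of `φ((S h)*)`. -/
def dualStar : Module.Dual ℂ H →ₛₗ[starRingEnd ℂ] Module.Dual ℂ H where
  toFun φ :=
    { toFun := fun h => conj (φ (star (HopfAlgebra.antipode ℂ h)))
      map_add' := fun g h => by simp only [map_add, star_add]
      map_smul' := fun c h => by simp [star_smul] }
  map_add' φ ψ := by ext h; simp
  map_smul' c φ := by ext h; simp

/-- The antilinear map `h ⊗ φ ↦ (φ* ▷) ∘ (h* ▷)`: the Weyl algebra `*`-structure
`(h ⊗ φ)* = (1 ⊗ φ*)(h* ⊗ 1)`, with values taken in `Lin(H)`. -/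
def weylStar : H ⊗[ℂ] Module.Dual ℂ H →ₛₗ[starRingEnd ℂ] Module.End ℂ H :=
  TensorProduct.lift
    (((LinearMap.mul ℂ (Module.End ℂ H)).flip.comp leftReg ∘ₛₗ
        (starLinearEquiv ℂ (A := H)).toLinearMap).compl₂ (coreg ∘ₛₗ dualStar))

/-- The sesquilinear form `(g, h) = ∫ g* h`, antilinear in `g` and linear in `h`. -/
def intForm (I : Module.Dual ℂ H) : H →ₛₗ[starRingEnd ℂ] H →ₗ[ℂ] ℂ :=
  ((LinearMap.mul ℂ H).compr₂ I) ∘ₛₗ (starLinearEquiv ℂ (A := H)).toLinearMap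

/-- The map `* ∘ S ∘ *`, which is the inverse of the antipode. -/
def antipodeInv : H →ₗ[ℂ] H :=
  (starLinearEquiv ℂ (A := H)).toLinearMap ∘ₛₗ HopfAlgebra.antipode ℂ ∘ₛₗ
    (starLinearEquiv ℂ (A := H)).toLinearMap

lemma star_lmul_antipode (t : H ⊗[ℂ] H) :
    LinearMap.mul' ℂ H (TensorProduct.comm ℂ H H ((antipodeInv (H := H)).rTensor H t)) =
      star (LinearMap.mul' ℂ H ((HopfAlgebra.antipode ℂ).rTensor H (star t))) := by
  induction t using TensorProduct.induction_on with
  | zero => simp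
  | tmul x y => simp [antipodeInv]
  | add x y hx hy => simp only [map_add, star_add, hx, hy]

variable [HopfStarAlgebra H]

/-- `* ∘ S ∘ *` is a skew antipode. -/
lemma skew_antipode (a : H) :
    LinearMap.mul' ℂ H (TensorProduct.comm ℂ H H
      ((antipodeInv (H := H)).rTensor H (Coalgebra.comul (R := ℂ) a))) =
      Coalgebra.counit (R := ℂ) a • (1 : H) := by
  rw [star_lmul_antipode, ← comul_star, HopfAlgebra.mul_antipode_rTensor_comul_apply, counit_star,
    Algebra.algebraMap_eq_smul_one, star_smul]
  simp

lemma weylRep_recover (h : H) (φ : Module.Dual ℂ H) (g : H) :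
    LinearMap.mul' ℂ H (TensorProduct.comm ℂ H H (TensorProduct.map antipodeInv
      (weylRep (h ⊗ₜ[ℂ] φ)) (Coalgebra.comul (R := ℂ) g))) = φ g • h := by
  -- `F (a ⊗ (b ⊗ c)) = h b S⁻¹(a) φ(c)`
  let M : H ⊗[ℂ] H →ₗ[ℂ] H := LinearMap.mul' ℂ H ∘ₗ (TensorProduct.comm ℂ H H).toLinearMap ∘ₗ
    (antipodeInv (H := H)).rTensor H
  let F : (H ⊗[ℂ] H) ⊗[ℂ] H →ₗ[ℂ] H := LinearMap.mulLeft ℂ h ∘ₗ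
    (TensorProduct.rid ℂ H).toLinearMap ∘ₗ TensorProduct.map M φ
  have h1 : LinearMap.mul' ℂ H ∘ₗ (TensorProduct.comm ℂ H H).toLinearMap ∘ₗ
      TensorProduct.map antipodeInv (weylRep (h ⊗ₜ[ℂ] φ)) =
      F ∘ₗ (TensorProduct.assoc ℂ H H H).symm.toLinearMap ∘ₗ
        (Coalgebra.comul (R := ℂ) (A := H)).lTensor H := by
    ext a b
    simp only [weylRep, coreg, leftReg, F, M, TensorProduct.AlgebraTensorModule.curry_apply,
      TensorProduct.curry_apply, LinearMap.coe_restrictScalars, LinearMap.comp_apply,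
      TensorProduct.map_tmul, LinearMap.lTensor_tmul, TensorProduct.lift.tmul,
      LinearMap.compl₁₂_apply, LinearEquiv.coe_coe, TensorProduct.comm_tmul,
      LinearMap.mul'_apply, LinearMap.mul_apply_apply, Module.End.mul_apply, LinearMap.coe_mk,
      AddHom.coe_mk]
    generalize (Coalgebra.comul (R := ℂ) b) = t
    induction t using TensorProduct.induction_on with
    | zero => simp
    | tmul x y => simp [mul_assoc]
    | add x y hx hy => simp only [map_add, TensorProduct.tmul_add, mul_add, add_mul, hx, hy]
  have h3 := congrArg F (Coalgebra.coassoc_symm_apply (R := ℂ) g)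
  have h1g := LinearMap.congr_fun h1 (Coalgebra.comul (R := ℂ) g)
  simp only [LinearMap.comp_apply, LinearEquiv.coe_coe] at h1g
  rw [h1g, h3]
  have h4 : F ∘ₗ (Coalgebra.comul (R := ℂ) (A := H)).rTensor H = LinearMap.mulLeft ℂ h ∘ₗ
      Algebra.linearMap ℂ H ∘ₗ φ ∘ₗ (TensorProduct.lid ℂ H).toLinearMap ∘ₗ
      (Coalgebra.counit (R := ℂ) (A := H)).rTensor H := by
    ext a b
    simp [F, M, skew_antipode, Algebra.algebraMap_eq_smul_one, smul_smul, mul_comm]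
  have h5 := LinearMap.congr_fun h4 (Coalgebra.comul (R := ℂ) g)
  simp only [LinearMap.comp_apply] at h5
  rw [h5, Coalgebra.rTensor_counit_comul]
  simp [Algebra.algebraMap_eq_smul_one]

lemma weylRep_injective [FiniteDimensional ℂ H] : Function.Injective (weylRep (H := H)) := by
  rw [injective_iff_map_eq_zero]
  intro t ht
  have key : ∀ (t : H ⊗[ℂ] Module.Dual ℂ H) (g : H),
      LinearMap.mul' ℂ H (TensorProduct.comm ℂ H H (TensorProduct.map antipodeInv
        (weylRep t) (Coalgebra.comul (R := ℂ) g))) =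
      dualTensorHom ℂ H H (TensorProduct.comm ℂ _ _ t) g := by
    intro t g
    induction t using TensorProduct.induction_on with
    | zero => simp
    | tmul h φ => rw [weylRep_recover]; simp
    | add x y hx hy => simp only [map_add, TensorProduct.map_add_right, LinearMap.add_apply, hx, hy]
  have h0 : dualTensorHomEquiv ℂ H H (TensorProduct.comm ℂ _ _ t) = 0 := by
    ext g
    have := key t g
    rw [ht] at this
    simpa using this.symm
  exact (LinearEquiv.map_eq_zero_iff _).1 ((LinearEquiv.map_eq_zero_iff _).1 h0)

/-- For finite-dimensional `H`, every operator on `H` is uniquely a sum of operators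
`(h ▷) ∘ (φ ▷)`: the linear isomorphism of the Weyl algebra with `Lin(H)`. -/
def weylEquiv [FiniteDimensional ℂ H] : H ⊗[ℂ] Module.Dual ℂ H ≃ₗ[ℂ] Module.End ℂ H :=
  LinearEquiv.ofInjectiveOfFinrankEq weylRep weylRep_injective
    (by simp [Module.finrank_linearMap])

/-- The `*`-structure of `Lin(H)` generated by those of `H` and `H*`: the antilinear map with
`((h ▷) ∘ (φ ▷))* = (φ* ▷) ∘ (h* ▷)`. -/
def opStar [FiniteDimensional ℂ H] : Module.End ℂ H →ₛₗ[starRingEnd ℂ] Module.End ℂ H :=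
  weylStar ∘ₛₗ (weylEquiv (H := H)).symm.toLinearMap

/-- The map `* ⊗ *` on `Lin(H ⊗ H) = Lin(H) ⊗ Lin(H)`. -/
def opStarTensor [FiniteDimensional ℂ H] :
    Module.End ℂ (H ⊗[ℂ] H) →ₛₗ[starRingEnd ℂ] Module.End ℂ (H ⊗[ℂ] H) :=
  (homTensorHomEquiv ℂ H H H H).toLinearMap ∘ₛₗ (TensorProduct.map opStar opStar) ∘ₛₗ
    (homTensorHomEquiv ℂ H H H H).symm.toLinearMap

end Star

end HopfStarAlgebra

end

/-! The operation `opStar` is the adjoint for the form `(g, h) = ∫ g* h`. Left multiplication has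
the right adjoint by associativity. For `φ ▷` the adjoint comes from `∫ (ψ ▷ a) b = ∫ a ((ψ ∘ S) ▷
b)` (`IsRightIntegral.coreg_mul`), a consequence of invariance. A nonzero integral gives a
nondegenerate form (`IsRightIntegral.eq_zero_of_mul`), so adjoints are unique. Being
anti-multiplicative then comes for free, as does being involutive once the form is hermitian.

A nonzero integral is found among the traces `x ↦ Tr((x ▷) ∘ R'_φ ∘ S⁻²)`. They cannot all vanish,
because the operators `(x ▷) ∘ R'_φ` span `Lin(H)` and `Tr 1 = dim H ≠ 0`. Nondegeneracy also gives
uniqueness: another integral is `∫ (· u)`, and invariance forces `u` to be a scalar.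

Unitarity of `W` is read off from `W = ∑ (eʲ ▷) ⊗ (e_j ▷)`, using `∑ (eʲ)*(y) e_j* = S y`. -/

namespace HopfStarAlgebra

open Coalgebra HopfAlgebra WithConv

/-! ### Convolution identities for the coproduct and the antipode -/

section Hopf

variable {H : Type*} [Ring H] [HopfAlgebra ℂ H]

/-- The inclusion `h ↦ h ⊗ 1`. -/
noncomputable def inclL (H : Type*) [Ring H] [HopfAlgebra ℂ H] : H →ₐ[ℂ] H ⊗[ℂ] H :=
  Algebra.TensorProduct.includeLeft

/-- The inclusion `h ↦ 1 ⊗ h`. -/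
noncomputable def inclR (H : Type*) [Ring H] [HopfAlgebra ℂ H] : H →ₐ[ℂ] H ⊗[ℂ] H :=
  Algebra.TensorProduct.includeRight

@[simp] lemma inclL_apply (h : H) : inclL H h = h ⊗ₜ[ℂ] 1 := rfl

@[simp] lemma inclR_apply (h : H) : inclR H h = 1 ⊗ₜ[ℂ] h := rfl

/-- Factoring `Δ` in the convolution algebra lets it be inverted one inclusion at a time. -/
lemma toConv_comul : toConv (comul (R := ℂ) (A := H)) =
    toConv (inclL H).toLinearMap * toConv (inclR H).toLinearMap := by
  ext h
  simp only [LinearMap.convMul_apply]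
  induction comul (R := ℂ) h using TensorProduct.induction_on with
  | zero => simp
  | tmul x y => simp
  | add x y hx hy => rw [map_add, map_add, ← hx, ← hy]

lemma algHom_mul_antipode {A : Type*} [Ring A] [Algebra ℂ A] (f : H →ₐ[ℂ] A) :
    toConv f.toLinearMap * toConv (f.toLinearMap ∘ₗ antipode ℂ) = 1 := by
  have h := LinearMap.algHom_comp_convMul_distrib f (toConv LinearMap.id)
    (toConv (antipode ℂ (A := H)))
  rw [LinearMap.id_mul_antipode] at h
  apply WithConv.ext
  rw [ofConv_toConv, LinearMap.comp_id] at h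
  rw [← h]
  ext x
  simp [LinearMap.convOne_def]

lemma antipode_mul_algHom {A : Type*} [Ring A] [Algebra ℂ A] (f : H →ₐ[ℂ] A) :
    toConv (f.toLinearMap ∘ₗ antipode ℂ) * toConv f.toLinearMap = 1 := by
  have h := LinearMap.algHom_comp_convMul_distrib f (toConv (antipode ℂ (A := H)))
    (toConv LinearMap.id)
  rw [LinearMap.antipode_mul_id] at h
  apply WithConv.ext
  rw [ofConv_toConv, LinearMap.comp_id] at h
  rw [← h]
  ext x
  simp [LinearMap.convOne_def]

/-- `Δ(h₍₁₎) (1 ⊗ S h₍₂₎) = h ⊗ 1`. -/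
lemma comul_mul_inclR_antipode :
    toConv (comul (R := ℂ) (A := H)) * toConv ((inclR H).toLinearMap ∘ₗ antipode ℂ) =
      toConv (inclL H).toLinearMap := by
  rw [toConv_comul, mul_assoc, algHom_mul_antipode, mul_one]

/-- Both sides are convolution inverses of `Δ`: one on the left, one on the right. -/
lemma comul_antipode (h : H) : comul (R := ℂ) (antipode ℂ h) =
    TensorProduct.comm ℂ H H (TensorProduct.map (antipode ℂ) (antipode ℂ) (comul (R := ℂ) h)) := by
  have h1 : toConv (comul (R := ℂ) (A := H) ∘ₗ antipode ℂ) =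
      toConv ((inclR H).toLinearMap ∘ₗ antipode ℂ) *
        toConv ((inclL H).toLinearMap ∘ₗ antipode ℂ) := by
    symm
    apply left_inv_eq_right_inv (a := toConv (comul (R := ℂ) (A := H)))
    · rw [toConv_comul, mul_assoc, ← mul_assoc (toConv ((inclL H).toLinearMap ∘ₗ _)),
        antipode_mul_algHom, one_mul, antipode_mul_algHom]
    · exact LinearMap.comul_right_inv
  have h2 := congrArg (fun f => f.ofConv h) h1
  simp only [LinearMap.convMul_apply, LinearMap.comp_apply] at h2
  rw [h2]
  induction comul (R := ℂ) h using TensorProduct.induction_on with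
  | zero => simp
  | tmul x y => simp
  | add x y hx hy => simp only [map_add, hx, hy]

/-! ### Coregular representations -/

lemma coreg_apply (φ : Module.Dual ℂ H) (g : H) :
    coreg φ g = TensorProduct.rid ℂ H (φ.lTensor H (comul (R := ℂ) g)) := rfl

/-- The right coregular representation `g ↦ φ(g₍₁₎) g₍₂₎`. -/
noncomputable def coregRight (φ : Module.Dual ℂ H) : Module.End ℂ H :=
  (TensorProduct.lid ℂ H).toLinearMap ∘ₗ φ.rTensor H ∘ₗ comul

lemma coregRight_apply (φ : Module.Dual ℂ H) (g : H) :
    coregRight φ g = TensorProduct.lid ℂ H (φ.rTensor H (comul (R := ℂ) g)) := rfl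

@[simp] lemma coreg_counit : coreg (counit (R := ℂ) (A := H)) = 1 := by
  ext g
  simp [coreg_apply]

@[simp] lemma leftReg_apply (h g : H) : leftReg h g = h * g := rfl

@[simp] lemma leftReg_one : leftReg (1 : H) = 1 := by ext; simp

lemma counit_coreg (φ : Module.Dual ℂ H) (g : H) : counit (R := ℂ) (coreg φ g) = φ g := by
  have h : ∀ t : H ⊗[ℂ] H, counit (R := ℂ) (TensorProduct.rid ℂ H (φ.lTensor H t)) =
      φ (TensorProduct.lid ℂ H ((counit (R := ℂ) (A := H)).rTensor H t)) := by
    intro t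
    induction t using TensorProduct.induction_on with
    | zero => simp
    | tmul x y => simp [mul_comm]
    | add x y hx hy => simp only [map_add, hx, hy]
  rw [coreg_apply, h, rTensor_counit_comul]
  simp

lemma coreg_mul_coreg (φ ψ : Module.Dual ℂ H) :
    coreg φ * coreg ψ = coreg (toConv φ * toConv ψ).ofConv := by
  ext g
  have h1 : ∀ t : H ⊗[ℂ] H, coreg φ (TensorProduct.rid ℂ H (ψ.lTensor H t)) =
      TensorProduct.rid ℂ H ((LinearMap.mul' ℂ ℂ ∘ₗ TensorProduct.map φ ψ).lTensor H
        (TensorProduct.assoc ℂ H H H (comul.rTensor H t))) := by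
    intro t
    induction t using TensorProduct.induction_on with
    | zero => simp
    | tmul x y =>
      simp only [LinearMap.lTensor_tmul, TensorProduct.rid_tmul, map_smul, coreg_apply,
        LinearMap.rTensor_tmul]
      induction comul (R := ℂ) x using TensorProduct.induction_on with
      | zero => simp
      | tmul u v => simp [smul_smul, mul_comm]
      | add u v hu hv => simp only [map_add, smul_add, TensorProduct.add_tmul, hu, hv]
    | add x y hx hy => simp only [map_add, hx, hy]
  rw [Module.End.mul_apply, coreg_apply ψ, h1, coassoc_apply, coreg_apply, LinearMap.convMul_def,
    ← LinearMap.lTensor_comp_apply]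
  rfl

lemma coreg_mul_coregRight (φ ψ : Module.Dual ℂ H) :
    coreg φ * coregRight ψ = coregRight ψ * coreg φ := by
  ext g
  have h1 : ∀ t : H ⊗[ℂ] H, coreg φ (TensorProduct.lid ℂ H (ψ.rTensor H t)) =
      TensorProduct.lid ℂ H (TensorProduct.map ψ ((TensorProduct.rid ℂ H).toLinearMap ∘ₗ
        φ.lTensor H) (comul.lTensor H t)) := by
    intro t
    induction t using TensorProduct.induction_on with
    | zero => simp
    | tmul x y => simp [coreg_apply]
    | add x y hx hy => simp only [map_add, hx, hy]
  have h2 : ∀ t : H ⊗[ℂ] H, coregRight ψ (TensorProduct.rid ℂ H (φ.lTensor H t)) =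
      TensorProduct.lid ℂ H (TensorProduct.map ψ ((TensorProduct.rid ℂ H).toLinearMap ∘ₗ
        φ.lTensor H) (TensorProduct.assoc ℂ H H H (comul.rTensor H t))) := by
    intro t
    induction t using TensorProduct.induction_on with
    | zero => simp
    | tmul x y =>
      simp only [LinearMap.lTensor_tmul, TensorProduct.rid_tmul, map_smul, coregRight_apply,
        LinearMap.rTensor_tmul]
      induction comul (R := ℂ) x using TensorProduct.induction_on with
      | zero => simp
      | tmul u v => simp [smul_smul]
      | add u v hu hv => simp only [map_add, smul_add, TensorProduct.add_tmul, hu, hv]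
    | add x y hx hy => simp only [map_add, hx, hy]
  rw [Module.End.mul_apply, Module.End.mul_apply, coregRight_apply, h1, coreg_apply, h2,
    coassoc_apply]

lemma coreg_antipode (φ : Module.Dual ℂ H) (g : H) :
    coreg φ (antipode ℂ g) = antipode ℂ (coregRight (φ ∘ₗ antipode ℂ) g) := by
  rw [coreg_apply, comul_antipode, coregRight_apply]
  induction comul (R := ℂ) g using TensorProduct.induction_on with
  | zero => simp
  | tmul x y => simp
  | add x y hx hy => simp only [map_add, hx, hy]

lemma coregRight_antipode (φ : Module.Dual ℂ H) (g : H) :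
    coregRight φ (antipode ℂ g) = antipode ℂ (coreg (φ ∘ₗ antipode ℂ) g) := by
  rw [coregRight_apply, comul_antipode, coreg_apply]
  induction comul (R := ℂ) g using TensorProduct.induction_on with
  | zero => simp
  | tmul x y => simp
  | add x y hx hy => simp only [map_add, hx, hy]

/-- Functionals separate points, so the defining identity may be tested against every `ψ`. -/
lemma isRightIntegral_iff (I : Module.Dual ℂ H) :
    IsRightIntegral I ↔ ∀ (ψ : Module.Dual ℂ H) (x : H), I (coreg ψ x) = ψ 1 * I x := by
  have h1 : ∀ (ψ : Module.Dual ℂ H) (x : H), I (coreg ψ x) =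
      ψ (TensorProduct.lid ℂ H (I.rTensor H (comul (R := ℂ) x))) := by
    intro ψ x
    rw [coreg_apply]
    induction comul (R := ℂ) x using TensorProduct.induction_on with
    | zero => simp
    | tmul x y => simp [mul_comm]
    | add x y hx hy => simp only [map_add, hx, hy]
  constructor
  · intro h ψ x
    rw [h1, h x, map_smul, smul_eq_mul, mul_comm]
  · intro h x
    rw [← sub_eq_zero, ← Module.forall_dual_apply_eq_zero_iff ℂ]
    intro ψ
    rw [map_sub, ← h1, h, map_smul, smul_eq_mul, mul_comm, sub_self]

/-! ### Sweedler sums written in a basis -/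

section Basis

variable {ι : Type*} [Fintype ι] (e : Module.Basis ι ℂ H)

lemma comul_eq_sum (g : H) :
    comul (R := ℂ) g = ∑ j, coreg (e.coord j) g ⊗ₜ[ℂ] e j := by
  simp only [coreg_apply]
  induction comul (R := ℂ) g using TensorProduct.induction_on with
  | zero => simp
  | tmul x y =>
    conv_lhs => rw [← e.sum_repr y]
    simp only [TensorProduct.tmul_sum, TensorProduct.tmul_smul, LinearMap.lTensor_tmul,
      TensorProduct.rid_tmul, TensorProduct.smul_tmul', e.coord_apply]
  | add x y hx hy => simp only [map_add, TensorProduct.add_tmul, Finset.sum_add_distrib, ← hx, ← hy]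

lemma dual_eq_sum (φ : Module.Dual ℂ H) : φ = ∑ j, φ (e j) • e.coord j := by
  ext x
  conv_lhs => rw [← e.sum_repr x]
  simp only [map_sum, map_smul, LinearMap.sum_apply, LinearMap.smul_apply, e.coord_apply,
    smul_eq_mul, mul_comm]

lemma coreg_eq_sum (φ : Module.Dual ℂ H) (g : H) :
    coreg φ g = ∑ j, φ (e j) • coreg (e.coord j) g := by
  conv_lhs => rw [dual_eq_sum e φ]
  simp only [map_sum, map_smul, LinearMap.sum_apply, LinearMap.smul_apply]

lemma tmul_one_eq_sum (g : H) :
    g ⊗ₜ[ℂ] (1 : H) =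
      ∑ j, comul (R := ℂ) (coreg (e.coord j) g) * (1 ⊗ₜ[ℂ] antipode ℂ (e j)) := by
  have h := congrArg (fun f => f.ofConv g) (comul_mul_inclR_antipode (H := H))
  simp only [LinearMap.convMul_apply, comul_eq_sum e g, map_sum] at h
  simpa using h.symm

/-- `ψ(x₍₂₎) x₍₁₎ g = ψ(x₍₂₎ g₍₂₎ S g₍₃₎) x₍₁₎ g₍₁₎`. -/
lemma coreg_apply_mul (ψ : Module.Dual ℂ H) (x g : H) :
    coreg ψ x * g = ∑ j, coreg (ψ ∘ₗ LinearMap.mulRight ℂ (antipode ℂ (e j)))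
      (x * coreg (e.coord j) g) := by
  have h1 : ∀ t : H ⊗[ℂ] H, TensorProduct.rid ℂ H (ψ.lTensor H t) * g =
      TensorProduct.rid ℂ H (ψ.lTensor H (t * (g ⊗ₜ[ℂ] 1))) := by
    intro t
    induction t using TensorProduct.induction_on with
    | zero => simp
    | tmul x y => simp
    | add x y hx hy => simp only [map_add, add_mul, hx, hy]
  have h2 : ∀ (t : H ⊗[ℂ] H) (u : H), TensorProduct.rid ℂ H (ψ.lTensor H (t * (1 ⊗ₜ[ℂ] u))) =
      TensorProduct.rid ℂ H ((ψ ∘ₗ LinearMap.mulRight ℂ u).lTensor H t) := by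
    intro t u
    induction t using TensorProduct.induction_on with
    | zero => simp
    | tmul x y => simp
    | add x y hx hy => simp only [map_add, add_mul, hx, hy]
  -- Since `g ⊗ 1 = Δ(g₍₁₎)(1 ⊗ S g₍₂₎)`, the product `Δ(x)(g ⊗ 1)` becomes `Δ(x g₍₁₎)(1 ⊗ S g₍₂₎)`.
  rw [coreg_apply, h1, tmul_one_eq_sum e g, Finset.mul_sum, map_sum, map_sum]
  refine Finset.sum_congr rfl fun j _ => ?_
  rw [← mul_assoc, ← Bialgebra.comul_mul, h2, ← coreg_apply]

end Basis

/-- Integrating `coreg_apply_mul` turns each outer `coreg` into its functional at `1`, namely `ψ(S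
e_j)`. These are the coefficients of `ψ ∘ S` in the dual basis. -/
lemma IsRightIntegral.coreg_mul [FiniteDimensional ℂ H] {I : Module.Dual ℂ H} (hI : IsRightIntegral I)
    (ψ : Module.Dual ℂ H) (a b : H) :
    I (coreg ψ a * b) = I (a * coreg (ψ ∘ₗ antipode ℂ) b) := by
  rw [isRightIntegral_iff] at hI
  rw [coreg_apply_mul (Module.finBasis ℂ H), coreg_eq_sum (Module.finBasis ℂ H) (ψ ∘ₗ _)]
  simp [hI, Finset.mul_sum]

/-! ### The fundamental operator, and operator identities for the trace argument -/

lemma fundOp_apply (g h : H) :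
    fundOp H (g ⊗ₜ[ℂ] h) = comul (R := ℂ) g * (1 ⊗ₜ[ℂ] h) := by
  simp only [fundOp, LinearMap.comp_apply, LinearMap.rTensor_tmul]
  induction comul (R := ℂ) g using TensorProduct.induction_on with
  | zero => simp
  | tmul x y => simp
  | add x y hx hy => simp only [TensorProduct.add_tmul, map_add, add_mul, hx, hy]

lemma fundOpInv_apply (g h : H) :
    fundOpInv H (g ⊗ₜ[ℂ] h) = (antipode ℂ).lTensor H (comul (R := ℂ) g) * (1 ⊗ₜ[ℂ] h) := by
  simp only [fundOpInv, LinearMap.comp_apply, LinearMap.rTensor_tmul]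
  induction comul (R := ℂ) g using TensorProduct.induction_on with
  | zero => simp
  | tmul x y => simp
  | add x y hx hy => simp only [TensorProduct.add_tmul, map_add, add_mul, hx, hy]

lemma fundOp_mul_fundOpInv [FiniteDimensional ℂ H] : fundOp H * fundOpInv H = 1 := by
  apply TensorProduct.ext'
  intro g h
  rw [Module.End.mul_apply, fundOpInv_apply, comul_eq_sum (Module.finBasis ℂ H) g]
  have h1 := congrArg (· * ((1 : H) ⊗ₜ[ℂ] h)) (tmul_one_eq_sum (Module.finBasis ℂ H) g)
  simp only [Finset.sum_mul, mul_assoc, Algebra.TensorProduct.tmul_mul_tmul, one_mul, mul_one]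
    at h1
  simp [Finset.sum_mul, fundOp_apply, h1]

lemma fundOpInv_mul_fundOp [FiniteDimensional ℂ H] : fundOpInv H * fundOp H = 1 :=
  mul_eq_one_comm.1 fundOp_mul_fundOpInv

/-- With `Φ = T ⋆ S` in the convolution algebra, `Φ ⋆ id = T`, that is `T y = Φ(y₍₁₎) y₍₂₎`. -/
lemma coregRight_span (T : Module.End ℂ H) {ι : Type*} [Fintype ι] (e : Module.Basis ι ℂ H) :
    ∑ k, leftReg ((toConv T * toConv (antipode ℂ)).ofConv (e k)) * coregRight (e.coord k) = T := by
  set Φ : H →ₗ[ℂ] H := (toConv T * toConv (antipode ℂ)).ofConv with hΦ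
  have h : toConv Φ * toConv LinearMap.id = toConv T := by
    rw [hΦ, toConv_ofConv, mul_assoc, LinearMap.antipode_mul_id, mul_one]
  ext y
  have h2 := congrArg (fun f => f.ofConv y) h
  simp only [LinearMap.convMul_apply] at h2
  rw [← h2]
  simp only [LinearMap.sum_apply, Module.End.mul_apply, leftReg_apply, coregRight_apply]
  induction comul (R := ℂ) y using TensorProduct.induction_on with
  | zero => simp
  | tmul u v =>
    have hu := congrArg (fun x => Φ x * v) (e.sum_repr u)
    simp only [map_sum, map_smul, Finset.sum_mul, smul_mul_assoc] at hu
    simpa using hu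
  | add x y hx hy => simp only [map_add, mul_add, Finset.sum_add_distrib, hx, hy]

/-- The combined functional at `z` is `ψ(S²(z₍₂₎) S(z₍₁₎)) = ψ(S(z₍₁₎ S z₍₂₎)) = ε(z) ψ(1)`. The
`S²` here is what the factor `S⁻²` in `traceIntegral` supplies. -/
lemma sum_coreg_mul_coreg {ι : Type*} [Fintype ι] (e : Module.Basis ι ℂ H)
    (ψ : Module.Dual ℂ H) :
    ∑ j, coreg (e.coord j) * coreg ((ψ ∘ₗ LinearMap.mulRight ℂ (antipode ℂ (e j))) ∘ₗ
      antipode ℂ ∘ₗ antipode ℂ) = ψ 1 • 1 := by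
  simp only [coreg_mul_coreg]
  rw [← map_sum, ← coreg_counit, ← map_smul]
  congr 1
  ext z
  simp only [LinearMap.sum_apply, LinearMap.convMul_apply, LinearMap.smul_apply, smul_eq_mul]
  have h := congrArg (fun x => ψ (antipode ℂ x)) (mul_antipode_lTensor_comul_apply (R := ℂ) z)
  simp only [Algebra.algebraMap_eq_smul_one, map_smul, antipode_one, smul_eq_mul] at h
  rw [mul_comm, ← h]
  induction comul (R := ℂ) z using TensorProduct.induction_on with
  | zero => simp
  | tmul u v =>
    have hu := congrArg (fun x => ψ (antipode ℂ (antipode ℂ v) * antipode ℂ x)) (e.sum_repr u)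
    simp only [map_sum, map_smul, Finset.mul_sum, mul_smul_comm] at hu
    simpa [antipode_mul_antidistrib] using hu
  | add x y hx hy => simp only [map_add, Finset.sum_add_distrib, hx, hy]

lemma weylRep_tmul (h : H) (φ : Module.Dual ℂ H) :
    weylRep (h ⊗ₜ[ℂ] φ) = leftReg h * coreg φ := rfl

lemma fundOp_eq_sum {ι : Type*} [Fintype ι] (e : Module.Basis ι ℂ H) :
    fundOp H = ∑ j, TensorProduct.map (coreg (e.coord j)) (leftReg (e j)) := by
  apply TensorProduct.ext'
  intro g h
  rw [fundOp_apply, comul_eq_sum e]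
  simp [Finset.sum_mul]

end Hopf

/-! ### The star structure and integrals -/

section Integral

variable {H : Type*} [Ring H] [StarRing H] [HopfAlgebra ℂ H] [StarModule ℂ H]

lemma antipodeInv_apply (h : H) : antipodeInv h = star (antipode ℂ (star h)) := rfl

@[simp] lemma antipodeInv_one : antipodeInv (1 : H) = 1 := by simp [antipodeInv_apply]

lemma dualStar_apply (φ : Module.Dual ℂ H) (h : H) :
    dualStar φ h = conj (φ (star (antipode ℂ h))) := rfl

lemma intForm_apply (I : Module.Dual ℂ H) (g h : H) : intForm I g h = I (star g * h) := rfl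

lemma intForm_leftReg (I : Module.Dual ℂ H) (h g g' : H) :
    intForm I (leftReg h g) g' = intForm I g (leftReg (star h) g') := by
  simp [intForm_apply, mul_assoc]

/-- The functional `x ↦ Tr((x ▷) ∘ R'_φ ∘ S⁻²)`, where `R'` is the right coregular
representation. -/
noncomputable def traceIntegral (φ : Module.Dual ℂ H) : Module.Dual ℂ H :=
  LinearMap.trace ℂ H ∘ₗ
    LinearMap.mulRight ℂ (coregRight φ * (antipodeInv ∘ₗ antipodeInv)) ∘ₗ leftReg

lemma traceIntegral_apply (φ : Module.Dual ℂ H) (x : H) :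
    traceIntegral φ x =
      LinearMap.trace ℂ H (leftReg x * (coregRight φ * (antipodeInv ∘ₗ antipodeInv))) := rfl

lemma weylStar_tmul (h : H) (φ : Module.Dual ℂ H) :
    weylStar (h ⊗ₜ[ℂ] φ) = coreg (dualStar φ) * leftReg (star h) := rfl

variable [HopfStarAlgebra H]

@[simp] lemma antipode_antipodeInv (h : H) : antipode ℂ (antipodeInv h) = h := antipode_star h

@[simp] lemma antipodeInv_antipode (h : H) : antipodeInv (antipode ℂ h) = h := by
  have := congrArg star (antipode_star (star h))
  rwa [star_star] at this

lemma antipodeInv_comp_antipode : antipodeInv (H := H) ∘ₗ antipode ℂ = LinearMap.id :=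
  LinearMap.ext antipodeInv_antipode

lemma antipode_injective : Function.Injective (antipode ℂ (A := H)) :=
  Function.LeftInverse.injective antipodeInv_antipode

lemma conj_apply_star (φ : Module.Dual ℂ H) (x : H) :
    (dualStar φ ∘ₗ antipodeInv) x = conj (φ (star x)) := by
  simp [dualStar_apply]

lemma star_coreg (φ : Module.Dual ℂ H) (g : H) :
    star (coreg φ g) = coreg (dualStar φ ∘ₗ antipodeInv) (star g) := by
  rw [coreg_apply, coreg_apply, comul_star]
  induction comul (R := ℂ) g using TensorProduct.induction_on with
  | zero => simp
  | tmul x y => simp [dualStar_apply]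
  | add x y hx hy => simp only [map_add, star_add, hx, hy]

/-- `S⁻¹(c₍₂₎) c₍₁₎ = ε(c) 1`. -/
lemma sum_antipodeInv_mul_coreg {ι : Type*} [Fintype ι] (e : Module.Basis ι ℂ H) (c : H) :
    ∑ j, antipodeInv (e j) * coreg (e.coord j) c = counit (R := ℂ) c • (1 : H) := by
  apply antipode_injective
  have h := mul_antipode_rTensor_comul_apply (R := ℂ) c
  rw [comul_eq_sum e c] at h
  simpa [antipode_mul_antidistrib, Algebra.algebraMap_eq_smul_one] using h

/-- The antipode exchanges the two coregular representations, so its square preserves each, up to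
twisting the functional. -/
lemma antipodeInv_sq_mul_coreg (ψ : Module.Dual ℂ H) :
    (antipodeInv ∘ₗ antipodeInv) * coreg ψ =
      coreg (ψ ∘ₗ antipode ℂ ∘ₗ antipode ℂ) * (antipodeInv ∘ₗ antipodeInv) := by
  ext g
  apply antipode_injective
  apply antipode_injective
  simp only [Module.End.mul_apply, LinearMap.comp_apply, antipode_antipodeInv]
  rw [← LinearMap.comp_assoc, ← coregRight_antipode, ← coreg_antipode]
  simp

/-- The functional `h ↦ conj (I (h*))`. -/
lemma IsRightIntegral.conj {I : Module.Dual ℂ H} (hI : IsRightIntegral I) :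
    IsRightIntegral (dualStar I ∘ₗ antipodeInv) := by
  rw [isRightIntegral_iff] at hI ⊢
  intro ψ x
  rw [conj_apply_star, conj_apply_star, star_coreg, hI, conj_apply_star]
  simp

variable [FiniteDimensional ℂ H]

lemma IsRightIntegral.intForm_coreg {I : Module.Dual ℂ H} (hI : IsRightIntegral I)
    (φ : Module.Dual ℂ H) (g g' : H) :
    intForm I (coreg φ g) g' = intForm I g (coreg (dualStar φ) g') := by
  rw [intForm_apply, intForm_apply, star_coreg, hI.coreg_mul, LinearMap.comp_assoc,
    antipodeInv_comp_antipode, LinearMap.comp_id]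

/-- The radical `{c | I (a c) = 0 for all a}` is stable under `coreg`, since `S` is invertible. If
it contained `c` with `ε(c) ≠ 0`, then `ε(c) 1 = S⁻¹(c₍₂₎) c₍₁₎` would force `I = 0`. So `ε` kills
the radical, and `ψ(b) = ε(ψ ▷ b) = 0` for all `ψ`. -/
lemma IsRightIntegral.eq_zero_of_mul {I : Module.Dual ℂ H} (hI : IsRightIntegral I) (hI0 : I ≠ 0)
    (b : H) (hb : ∀ a, I (a * b) = 0) : b = 0 := by
  have key : ∀ c : H, (∀ a, I (a * c) = 0) → ∀ (ψ : Module.Dual ℂ H) (a : H),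
      I (a * coreg ψ c) = 0 := by
    intro c hc ψ a
    rw [← LinearMap.comp_id ψ, ← antipodeInv_comp_antipode, ← LinearMap.comp_assoc,
      ← hI.coreg_mul, hc]
  have hε : ∀ c : H, (∀ a, I (a * c) = 0) → counit (R := ℂ) c = 0 := by
    intro c hc
    by_contra h0
    apply hI0
    ext a
    have h := congrArg (fun x => I (a * x)) (sum_antipodeInv_mul_coreg (Module.finBasis ℂ H) c)
    simp only [Finset.mul_sum, map_sum, ← mul_assoc, key c hc, Finset.sum_const_zero,
      mul_smul_comm, map_smul, mul_one, smul_eq_mul] at h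
    simpa [h0] using h.symm
  rw [← Module.forall_dual_apply_eq_zero_iff ℂ]
  intro ψ
  rw [← counit_coreg]
  exact hε _ (key b hb ψ)

lemma IsRightIntegral.unique {I J : Module.Dual ℂ H} (hI : IsRightIntegral I) (hI0 : I ≠ 0)
    (hJ : IsRightIntegral J) : ∃ c : ℂ, J = c • I := by
  let F : H →ₗ[ℂ] Module.Dual ℂ H := (LinearMap.mul ℂ H).flip.compr₂ I
  have hF : Function.Injective F := by
    rw [injective_iff_map_eq_zero]
    exact fun b hb => hI.eq_zero_of_mul hI0 b fun a => LinearMap.congr_fun hb a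
  obtain ⟨u, hu⟩ := (LinearMap.injective_iff_surjective_of_finrank_eq_finrank
    (Subspace.dual_finrank_eq (K := ℂ) (V := H)).symm).1 hF J
  have hJu : ∀ x, J x = I (x * u) := fun x => (LinearMap.congr_fun hu x).symm
  have h1 : ∀ ψ : Module.Dual ℂ H, coreg ψ u = ψ 1 • u := by
    intro ψ
    rw [← sub_eq_zero]
    refine hI.eq_zero_of_mul hI0 _ fun a => ?_
    -- Testing with `ψ ∘ S⁻¹` cancels the antipode that `coreg_mul` introduces.
    have h2 := (isRightIntegral_iff J).1 hJ (ψ ∘ₗ antipodeInv) a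
    rw [hJu, hJu, hI.coreg_mul, LinearMap.comp_assoc, antipodeInv_comp_antipode,
      LinearMap.comp_id, LinearMap.comp_apply, antipodeInv_one] at h2
    rw [mul_sub, map_sub, h2, mul_smul_comm, map_smul, smul_eq_mul, sub_self]
  have h3 : u = counit (R := ℂ) u • (1 : H) := by
    rw [← sub_eq_zero, ← Module.forall_dual_apply_eq_zero_iff ℂ]
    intro ψ
    rw [map_sub, ← counit_coreg ψ u, h1]
    simp [mul_comm]
  refine ⟨counit (R := ℂ) u, LinearMap.ext fun x => ?_⟩
  rw [hJu, h3]
  simp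

/-! ### Existence of a nonzero, hermitian integral -/

lemma isRightIntegral_traceIntegral (φ : Module.Dual ℂ H) :
    IsRightIntegral (traceIntegral φ) := by
  rw [isRightIntegral_iff]
  intro ψ x
  let e := Module.finBasis ℂ H
  have h : leftReg (coreg ψ x) = ∑ j, coreg (ψ ∘ₗ LinearMap.mulRight ℂ (antipode ℂ (e j))) *
      (leftReg x * coreg (e.coord j)) := by
    ext g
    simp [coreg_apply_mul e]
  have h2 : ∀ j, LinearMap.trace ℂ H (coreg (ψ ∘ₗ LinearMap.mulRight ℂ (antipode ℂ (e j))) *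
      (leftReg x * coreg (e.coord j)) * (coregRight φ * (antipodeInv ∘ₗ antipodeInv))) =
      LinearMap.trace ℂ H (leftReg x * coregRight φ * (coreg (e.coord j) *
        coreg ((ψ ∘ₗ LinearMap.mulRight ℂ (antipode ℂ (e j))) ∘ₗ antipode ℂ ∘ₗ antipode ℂ)) *
        (antipodeInv ∘ₗ antipodeInv)) := by
    intro j
    -- Cyclicity carries the outer `coreg` to the far right; it then passes `S⁻²`, picking up `S²`,
    -- and commutes with `coregRight φ`, so that `sum_coreg_mul_coreg` applies.
    rw [mul_assoc (coreg _), LinearMap.trace_mul_comm]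
    congr 1
    simp only [mul_assoc, antipodeInv_sq_mul_coreg]
    rw [← mul_assoc (coreg (e.coord j)) (coregRight φ), coreg_mul_coregRight, mul_assoc]
  rw [traceIntegral_apply, h, Finset.sum_mul, map_sum, Finset.sum_congr rfl fun j _ => h2 j,
    ← map_sum, ← Finset.sum_mul, ← Finset.mul_sum, sum_coreg_mul_coreg]
  simp [traceIntegral_apply, mul_assoc]

lemma exists_isRightIntegral_ne_zero : ∃ I : Module.Dual ℂ H, I ≠ 0 ∧ IsRightIntegral I := by
  by_contra! hcon
  have h0 : ∀ φ : Module.Dual ℂ H, traceIntegral φ = 0 := fun φ => by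
    by_contra h
    exact hcon _ h (isRightIntegral_traceIntegral φ)
  have h1 : ∀ T : Module.End ℂ H,
      LinearMap.trace ℂ H (T * (antipodeInv ∘ₗ antipodeInv)) = 0 := by
    intro T
    rw [← coregRight_span T (Module.finBasis ℂ H), Finset.sum_mul, map_sum]
    refine Finset.sum_eq_zero fun k _ => ?_
    rw [mul_assoc, ← traceIntegral_apply, h0, LinearMap.zero_apply]
  -- The choice `T = S²` makes the trace equal to `dim H`, which is nonzero because `ε(1) = 1`.
  have h2 : (antipode ℂ ∘ₗ antipode ℂ) * (antipodeInv ∘ₗ antipodeInv) = (1 : Module.End ℂ H) := by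
    ext x
    simp
  have h3 := h1 (antipode ℂ ∘ₗ antipode ℂ)
  rw [h2, LinearMap.trace_one, Nat.cast_eq_zero, Module.finrank_zero_iff] at h3
  have h4 := Bialgebra.counit_one (R := ℂ) (A := H)
  rw [Subsingleton.elim (1 : H) 0, map_zero] at h4
  exact zero_ne_one h4

lemma exists_hermitian_isRightIntegral : ∃ I : Module.Dual ℂ H, I ≠ 0 ∧ IsRightIntegral I ∧
    ∀ g h : H, intForm I g h = starRingEnd ℂ (intForm I h g) := by
  suffices h : ∃ I : Module.Dual ℂ H, I ≠ 0 ∧ IsRightIntegral I ∧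
      ∀ x, I (star x) = starRingEnd ℂ (I x) by
    obtain ⟨I, h0, hI, h⟩ := h
    refine ⟨I, h0, hI, fun g h' => ?_⟩
    rw [intForm_apply, intForm_apply, ← h, star_mul, star_star]
  obtain ⟨I, h0, hI⟩ := exists_isRightIntegral_ne_zero (H := H)
  have hI' := hI.conj
  set J := dualStar I ∘ₗ antipodeInv with hJ
  have hJs : ∀ x, J x = starRingEnd ℂ (I (star x)) := conj_apply_star I
  rw [isRightIntegral_iff] at hI hI'
  -- `I + J` is real for `*`; if it vanishes, `I (x*) = -conj (I x)` and multiplying by `i` repairs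
  -- the sign.
  by_cases hs : I + J = 0
  · refine ⟨Complex.I • I, smul_ne_zero Complex.I_ne_zero h0, ?_, fun x => ?_⟩
    · rw [isRightIntegral_iff]
      intro ψ x
      simp only [LinearMap.smul_apply, hI, smul_eq_mul]
      ring
    · have h1 := LinearMap.congr_fun hs (star x)
      simp only [LinearMap.add_apply, hJs, star_star, LinearMap.zero_apply] at h1
      simp only [LinearMap.smul_apply, smul_eq_mul, map_mul, Complex.conj_I]
      linear_combination Complex.I * h1
  · refine ⟨I + J, hs, ?_, fun x => ?_⟩
    · rw [isRightIntegral_iff]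
      intro ψ x
      simp only [LinearMap.add_apply, hI, hI']
      ring
    · simp [hJs, add_comm]

/-! ### The star of an operator as its adjoint -/

lemma opStar_weylRep (t : H ⊗[ℂ] Module.Dual ℂ H) : opStar (weylRep t) = weylStar t :=
  congrArg weylStar ((weylEquiv (H := H)).symm_apply_apply t)

lemma IsRightIntegral.intForm_opStar {I : Module.Dual ℂ H} (hI : IsRightIntegral I)
    (T : Module.End ℂ H) (g g' : H) : intForm I (T g) g' = intForm I g (opStar T g') := by
  obtain ⟨t, rfl⟩ := (weylEquiv (H := H)).surjective T
  change intForm I (weylRep t g) g' = intForm I g (opStar (weylRep t) g')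
  rw [opStar_weylRep]
  induction t using TensorProduct.induction_on with
  | zero => simp
  | tmul h φ =>
    rw [weylRep_tmul, weylStar_tmul, Module.End.mul_apply, Module.End.mul_apply,
      intForm_leftReg, hI.intForm_coreg]
  | add x y hx hy => simp only [map_add, LinearMap.add_apply, hx, hy]

lemma IsRightIntegral.end_ext {I : Module.Dual ℂ H} (hI : IsRightIntegral I) (hI0 : I ≠ 0)
    {X Y : Module.End ℂ H} (h : ∀ g g', intForm I g (X g') = intForm I g (Y g')) : X = Y := by
  ext g'
  rw [← sub_eq_zero]
  refine hI.eq_zero_of_mul hI0 _ fun a => ?_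
  have := h (star a) g'
  rw [intForm_apply, intForm_apply, star_star] at this
  rw [mul_sub, map_sub, this, sub_self]

lemma opStar_opStar (T : Module.End ℂ H) : opStar (opStar T) = T := by
  obtain ⟨I, h0, hI, hh⟩ := exists_hermitian_isRightIntegral (H := H)
  refine hI.end_ext h0 fun g g' => ?_
  rw [← hI.intForm_opStar, hh, ← hI.intForm_opStar, ← hh]

lemma opStar_mul (T T' : Module.End ℂ H) : opStar (T * T') = opStar T' * opStar T := by
  obtain ⟨I, h0, hI⟩ := exists_isRightIntegral_ne_zero (H := H)
  refine hI.end_ext h0 fun g g' => ?_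
  rw [← hI.intForm_opStar, Module.End.mul_apply, Module.End.mul_apply, hI.intForm_opStar,
    hI.intForm_opStar]

lemma opStar_leftReg (h : H) : opStar (leftReg h) = leftReg (star h) := by
  obtain ⟨I, h0, hI⟩ := exists_isRightIntegral_ne_zero (H := H)
  refine hI.end_ext h0 fun g g' => ?_
  rw [← hI.intForm_opStar, intForm_leftReg]

lemma opStar_coreg (φ : Module.Dual ℂ H) : opStar (coreg φ) = coreg (dualStar φ) := by
  obtain ⟨I, h0, hI⟩ := exists_isRightIntegral_ne_zero (H := H)
  refine hI.end_ext h0 fun g g' => ?_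
  rw [← hI.intForm_opStar, hI.intForm_coreg]

/-! ### Unitarity of the fundamental operator -/

lemma opStarTensor_map (S T : Module.End ℂ H) :
    opStarTensor (TensorProduct.map S T) = TensorProduct.map (opStar S) (opStar T) := by
  have h : ∀ S T : Module.End ℂ H,
      homTensorHomEquiv ℂ H H H H (S ⊗ₜ[ℂ] T) = TensorProduct.map S T := fun S T => by
    rw [homTensorHomEquiv_apply]
    rfl
  change homTensorHomEquiv ℂ H H H H (TensorProduct.map opStar opStar
    ((homTensorHomEquiv ℂ H H H H).symm (TensorProduct.map S T))) = _
  rw [← h S T, LinearEquiv.symm_apply_apply, TensorProduct.map_tmul, h]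

lemma opStarTensor_fundOp : opStarTensor (fundOp H) = fundOpInv H := by
  let e := Module.finBasis ℂ H
  rw [fundOp_eq_sum e, map_sum]
  simp only [opStarTensor_map, opStar_coreg, opStar_leftReg]
  -- This is the star of the basis expansion of `(S y)*`; it is how the antipode of `W⁻¹` arises.
  have key : ∀ y : H, ∑ j, dualStar (e.coord j) y • star (e j) = antipode ℂ y := by
    intro y
    have h := congrArg star (e.sum_repr (star (antipode ℂ y)))
    rw [star_star] at h
    rw [← h, star_sum]
    simp only [star_smul, dualStar_apply, e.coord_apply]
    rfl
  apply TensorProduct.ext'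
  intro g h
  rw [fundOpInv_apply]
  simp only [LinearMap.sum_apply, TensorProduct.map_tmul, coreg_apply, leftReg_apply]
  induction comul (R := ℂ) g using TensorProduct.induction_on with
  | zero => simp
  | tmul u v =>
    rw [LinearMap.lTensor_tmul, ← key]
    simp [TensorProduct.tmul_sum, Finset.sum_mul, TensorProduct.smul_tmul']
  | add x y hx hy =>
    simp only [map_add, add_mul, TensorProduct.add_tmul, Finset.sum_add_distrib, hx, hy]

end Integral

end HopfStarAlgebra

theorem proposition3p3 {H : Type*} [Ring H] [StarRing H] [HopfAlgebra ℂ H] [StarModule ℂ H]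
    [HopfStarAlgebra H] [FiniteDimensional ℂ H] :
    -- `opStar` is a `*`-structure on the algebra `Lin(H)` extending those of `H` and `H*`
    ((∀ T : Module.End ℂ H, HopfStarAlgebra.opStar (HopfStarAlgebra.opStar T) = T) ∧
      (∀ T T' : Module.End ℂ H, HopfStarAlgebra.opStar (T * T') =
        HopfStarAlgebra.opStar T' * HopfStarAlgebra.opStar T) ∧
      (∀ h : H, HopfStarAlgebra.opStar (HopfStarAlgebra.leftReg h) =
        HopfStarAlgebra.leftReg (star h)) ∧
      (∀ φ : Module.Dual ℂ H, HopfStarAlgebra.opStar (HopfStarAlgebra.coreg φ) =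
        HopfStarAlgebra.coreg (HopfStarAlgebra.dualStar φ))) ∧
    -- the fundamental operator is unitary
    (HopfStarAlgebra.fundOp H * HopfStarAlgebra.fundOpInv H = 1 ∧
      HopfStarAlgebra.fundOpInv H * HopfStarAlgebra.fundOp H = 1 ∧
      HopfStarAlgebra.opStarTensor (HopfStarAlgebra.fundOp H) = HopfStarAlgebra.fundOpInv H) ∧
    -- the right-invariant integral exists, is unique up to scale, and its scale can be chosen
    -- so that the sesquilinear form is hermitian
    (∃ I : Module.Dual ℂ H, I ≠ 0 ∧ HopfStarAlgebra.IsRightIntegral I ∧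
      (∀ g h : H, HopfStarAlgebra.intForm I g h =
        starRingEnd ℂ (HopfStarAlgebra.intForm I h g)) ∧
      (∀ J : Module.Dual ℂ H, HopfStarAlgebra.IsRightIntegral J → ∃ c : ℂ, J = c • I)) ∧
    -- the form is compatible with the `*`-structure
    (∀ I : Module.Dual ℂ H, HopfStarAlgebra.IsRightIntegral I →
      (∀ h g g' : H, HopfStarAlgebra.intForm I (HopfStarAlgebra.leftReg h g) g' =
        HopfStarAlgebra.intForm I g (HopfStarAlgebra.leftReg (star h) g')) ∧
      (∀ (φ : Module.Dual ℂ H) (g g' : H),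
        HopfStarAlgebra.intForm I (HopfStarAlgebra.coreg φ g) g' =
          HopfStarAlgebra.intForm I g
            (HopfStarAlgebra.coreg (HopfStarAlgebra.dualStar φ) g'))) := by
  refine ⟨⟨HopfStarAlgebra.opStar_opStar, HopfStarAlgebra.opStar_mul,
    HopfStarAlgebra.opStar_leftReg, HopfStarAlgebra.opStar_coreg⟩,
    ⟨HopfStarAlgebra.fundOp_mul_fundOpInv, HopfStarAlgebra.fundOpInv_mul_fundOp,
      HopfStarAlgebra.opStarTensor_fundOp⟩, ?_,
    fun I hI => ⟨HopfStarAlgebra.intForm_leftReg I, hI.intForm_coreg⟩⟩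
  obtain ⟨I, h0, hI, hh⟩ := HopfStarAlgebra.exists_hermitian_isRightIntegral (H := H)
  exact ⟨I, h0, hI, hh, fun J hJ => hI.unique h0 hJ⟩
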